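/- All digraphs are finite and have no loops and no digons (directed cycles of length $2$). For a vertex $v$ of a digraph $D$, let $N^+(v)$ be its set of out-neighbours and $N^{++}(v)$ the set of vertices at distance exactly $2$ from $v$. The vertex $v$ has the second neighbourhood property (SNP) if $|N^+(v)|\le |N^{++}(v)|$, and it is a sink if $N^+(v)=\emptyset$. A missing edge of $D$ is an unordered pair $\{a,b\}$ of distinct vertices with neither $a\to b$ nor $b\to a$ in $D$. A missing edge $e$ loses to a missing edge $f$ if one can write $e=\{x_1,y_1\}$ and $f=\{x_2,y_2\}$ such that $x_1\to x_2$, $y_2\notin N^+(x_1)\cup N^{++}(x_1)$, $y_1\to y_2$ and $x_2\notin N^+(y_1)\cup N^{++}(y_1)$. The dependency digraph $\Delta$ of $D$ (which, exceptionally, may contain digons) has the missing edges of $D$ as vertices, with an arc from $e$ to $f$ whenever $e$ loses to $f$; let $\delta^+_\Delta$ and $\delta^-_\Delta$ be its minimum out-degree and minimum in-degree. Theorem 9. Let $D$ be a digraph obtained from a tournament by deleting the edges of three stars with pairwise disjoint vertex sets, whose centres form a directed triangle in $D$. If $\delta^+_\Delta>0$, $\delta^-_\Delta>0$ and $D$ has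 no sink, then $D$ has at least two vertices with the SNP. -/

import Mathlib

/-! Loops are not excluded by `Digraph`; tournaments below are loopless and without digons. -/

namespace Digraph

variable {V : Type*}

/-- A tournament: no loops, and exactly one of the two arcs between any two distinct vertices. -/
structure IsTournament (T : Digraph V) : Prop where
  loopless : ∀ v, ¬ T.Adj v v
  connected : ∀ u v, u ≠ v → T.Adj u v ∨ T.Adj v u
  no_digon : ∀ u v, T.Adj u v → ¬ T.Adj v u

/-- The out-neighborhood `N⁺(v)`. -/
def outNbhd (D : Digraph V) (v : V) : Set V := {w | D.Adj v w}

/-- The in-neighborhood `N⁻(v)`. -/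
def inNbhd (D : Digraph V) (v : V) : Set V := {w | D.Adj w v}

/-- The second out-neighborhood `N⁺⁺(v)`: the vertices at distance exactly two from `v`. -/
def secondOutNbhd (D : Digraph V) (v : V) : Set V :=
  {w | w ≠ v ∧ ¬ D.Adj v w ∧ ∃ u, D.Adj v u ∧ D.Adj u w}

/-- The out-degree `d⁺(v)`. -/
noncomputable def outDegree (D : Digraph V) (v : V) : ℕ∞ := (D.outNbhd v).encard

/-- The in-degree `d⁻(v)`. -/
noncomputable def inDegree (D : Digraph V) (v : V) : ℕ∞ := (D.inNbhd v).encard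

/-- The second out-degree `d⁺⁺(v)`. -/
noncomputable def secondOutDegree (D : Digraph V) (v : V) : ℕ∞ := (D.secondOutNbhd v).encard

/-- The minimum out-degree `δ⁺` (equal to `⊤` if there are no vertices). -/
noncomputable def minOutDegree (D : Digraph V) : ℕ∞ := ⨅ v, D.outDegree v

/-- The minimum in-degree `δ⁻` (equal to `⊤` if there are no vertices). -/
noncomputable def minInDegree (D : Digraph V) : ℕ∞ := ⨅ v, D.inDegree v

/-- A sink is a vertex of out-degree zero. -/
def IsSink (D : Digraph V) (v : V) : Prop := D.outDegree v = 0

/-- The second neighborhood property: `d⁺(v) ≤ d⁺⁺(v)`. -/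
def HasSNP (D : Digraph V) (v : V) : Prop := D.outDegree v ≤ D.secondOutDegree v

/-- The missing edges of `D`: unordered pairs of distinct vertices with no arc between them,
as the edges of a simple graph on all of `V`. -/
def missingGraph (D : Digraph V) : SimpleGraph V where
  Adj u v := u ≠ v ∧ ¬ D.Adj u v ∧ ¬ D.Adj v u
  symm := ⟨fun _ _ h => ⟨h.1.symm, h.2.2, h.2.1⟩⟩
  loopless := ⟨fun _ h => h.1 rfl⟩

/-- The missing edge `e` loses to the missing edge `f`: for some naming of the endpoints
`e = x₁y₁` and `f = x₂y₂` we have `x₁ → x₂`, `y₂ ∉ N⁺(x₁) ∪ N⁺⁺(x₁)`, `y₁ → y₂` and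
`x₂ ∉ N⁺(y₁) ∪ N⁺⁺(y₁)`. -/
def LosesTo (D : Digraph V) (e f : Sym2 V) : Prop :=
  ∃ x₁ y₁ x₂ y₂ : V, e = s(x₁, y₁) ∧ f = s(x₂, y₂) ∧
    D.Adj x₁ x₂ ∧ y₂ ∉ D.outNbhd x₁ ∪ D.secondOutNbhd x₁ ∧
    D.Adj y₁ y₂ ∧ x₂ ∉ D.outNbhd y₁ ∪ D.secondOutNbhd y₁

/-- The dependency digraph `Δ` of `D`: its vertices are the missing edges of `D`, with an arc
from `e` to `f` when `e` loses to `f`. -/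
def dependencyDigraph (D : Digraph V) : Digraph D.missingGraph.edgeSet where
  Adj e f := D.LosesTo e f

/-- Delete from `D` all the arcs (in both directions) between the two ends of an edge in `S`. -/
def deleteEdges (D : Digraph V) (S : Set (Sym2 V)) : Digraph V where
  Adj u v := D.Adj u v ∧ s(u, v) ∉ S

end Digraph

/-- A star on vertices of `V`: a center joined to each of a set of leaves. -/
structure StarGraph (V : Type*) where
  center : V
  leaves : Set V
  center_notMem : center ∉ leaves

namespace StarGraph

variable {V : Type*}

/-- The vertex set of a star. -/
def verts (S : StarGraph V) : Set V := insert S.center S.leaves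

/-- The edge set of a star. -/
def edges (S : StarGraph V) : Set (Sym2 V) := {e | ∃ a ∈ S.leaves, e = s(S.center, a)}

end StarGraph

/-! Write x, y, z for the centres of `X`, `Y`, `Z` and A, B, C for their leaf sets. Since x → y → z
→ x, a missing edge of one star can lose only to a missing edge of the next. Positive degrees in Δ
then force A → B → C → A, y → A → z, z → B → x and x → C → y. If there are leaves at all, they also
make the union K of the stars a module: all its vertices have the same neighbours outside
(`adj_iff_adj_X_center`).

Contracting K to one vertex of weight |K| leaves a weighted tournament. The last vertex of a
weighted median order has the weighted second neighbourhood property. If that vertex is not K, it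
has weight 1 and is not a sink, so a second such vertex exists (`exists_ne_hasWeightedSNP`).
Vertices found outside K have the SNP in D.

If K is one of those found, its out-neighbours outside are balanced by second out-neighbours
outside, and two vertices inside K are sought instead (`exists_hasSNP_of_encard_le`). Up to rotation
|C| ≤ |A|. The out-neighbours y, C of x in K are then balanced by z, A, and the out-neighbours x, C
of any b in B by y, A. It remains to choose b with the SNP in the tournament on B. -/

/-! ### Weighted median orders of tournaments. -/

open Finset in
/-- In the subdigraph induced on `S`, the weight of the out-neighbourhood of `v` is at most
the weight of its second out-neighbourhood. -/
def Digraph.HasWeightedSNP {V : Type*} (D : Digraph V) (S : Finset V) (ω : V → ℕ) (v : V) : Prop :=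
  open Classical in
  ∑ w ∈ S with D.Adj v w, ω w ≤
    ∑ w ∈ S with w ≠ v ∧ ¬ D.Adj v w ∧ ∃ u ∈ S, D.Adj v u ∧ D.Adj u w, ω w

/-- The sum of `c u v` over the pairs where `u` precedes `v` in the list. -/
def List.orderedPairSum {V : Type*} (c : V → V → ℕ) : List V → ℕ
  | [] => 0
  | a :: l => (l.map (c a)).sum + orderedPairSum c l

namespace List

variable {V : Type*} (c : V → V → ℕ)

/-- Moving b across the block s reverses only the pairs formed by b and an element of s. -/
theorem orderedPairSum_move (p s q : List V) (b : V) :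
    (p ++ (b :: (s ++ q))).orderedPairSum c + (s.map (fun u => c u b)).sum =
      (p ++ (s ++ b :: q)).orderedPairSum c + (s.map (c b)).sum := by
  induction p with
  | nil =>
    induction s with
    | nil => simp
    | cons a s ih =>
      simp only [orderedPairSum, map_append, sum_append, map_cons, sum_cons, nil_append,
        cons_append] at ih ⊢
      omega
  | cons a p ih =>
    have h : ((p ++ (b :: (s ++ q))).map (c a)).sum = ((p ++ (s ++ b :: q)).map (c a)).sum := by
      simp only [map_append, sum_append, map_cons, sum_cons]
      omega
    simp only [orderedPairSum, cons_append, h]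
    omega

/-- A global maximum over all orderings does not improve when b is moved to the front of a block s
just before it. -/
theorem exists_max_orderedPairSum [DecidableEq V] (S : Finset V) :
    ∃ l : List V, l.Nodup ∧ l.toFinset = S ∧ ∀ p s b q, l = p ++ (s ++ b :: q) →
      ∑ u ∈ s.toFinset, c b u ≤ ∑ u ∈ s.toFinset, c u b := by
  obtain ⟨l, hl, hmax⟩ := S.toList.permutations.toFinset.exists_max_image
    (orderedPairSum c) ⟨S.toList, by simp⟩
  simp only [mem_toFinset, mem_permutations] at hl hmax
  have hnd : l.Nodup := hl.nodup_iff.2 S.nodup_toList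
  refine ⟨l, hnd, ?_, ?_⟩
  · ext v
    simp [hl.mem_iff]
  · rintro p s b q rfl
    have hs : s.Nodup := (hnd.of_append_right).of_append_left
    rw [List.sum_toFinset _ hs, List.sum_toFinset _ hs]
    have h1 := orderedPairSum_move c p s q b
    have h2 := hmax (p ++ (b :: (s ++ q))) ((Perm.append_left p perm_middle.symm).trans hl)
    change (s.map (c b)).sum ≤ _
    omega

end List

namespace Digraph

variable {V : Type*} {D : Digraph V} {S : Finset V} {ω : V → ℕ}

open Classical in
/-- A median order of the tournament on `S` which, among median orders, puts `t` as late as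
possible. -/
theorem exists_medianOrder (hω : ∀ v ∈ S, 1 ≤ ω v) (t : V) :
    ∃ l : List V, l.Nodup ∧ l.toFinset = S ∧ ∀ p s b q, l = p ++ (s ++ b :: q) →
      (∑ u ∈ s.toFinset with D.Adj b u, ω u ≤ ∑ u ∈ s.toFinset with D.Adj u b, ω u) ∧
      (t ∈ s →
        ∑ u ∈ s.toFinset with D.Adj b u, ω u < ∑ u ∈ s.toFinset with D.Adj u b, ω u) := by
  -- Lexicographic objective: the second summand counts the predecessors of t. There are fewer than
  -- `S.card + 1` of them, so this only breaks ties in the forward weight.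
  obtain ⟨l, hnd, hS, hl⟩ := List.exists_max_orderedPairSum
    (fun u v => (S.card + 1) * (ω u * (if D.Adj u v then ω v else 0)) + if v = t then 1 else 0) S
  refine ⟨l, hnd, hS, ?_⟩
  rintro p s b q rfl
  have h := hl p s b q rfl
  have hb : 1 ≤ ω b := hω b (by simp [← hS])
  have hcard : s.toFinset.card ≤ S.card := by
    refine Finset.card_le_card ?_
    rw [← hS]
    intro v
    simp +contextual
  have e1 : ∑ u ∈ s.toFinset, (S.card + 1) * (ω b * (if D.Adj b u then ω u else 0)) =
      (S.card + 1) * (ω b * ∑ u ∈ s.toFinset with D.Adj b u, ω u) := by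
    rw [Finset.sum_filter, Finset.mul_sum, Finset.mul_sum]
  have e2 : ∑ u ∈ s.toFinset, (S.card + 1) * (ω u * (if D.Adj u b then ω b else 0)) =
      (S.card + 1) * (ω b * ∑ u ∈ s.toFinset with D.Adj u b, ω u) := by
    rw [Finset.sum_filter, Finset.mul_sum, Finset.mul_sum]
    refine Finset.sum_congr rfl fun u _ => ?_
    split_ifs <;> ring
  have e3 : ∑ u ∈ s.toFinset, (if u = t then 1 else 0) = if t ∈ s then 1 else 0 := by
    simp
  have e4 : ∑ u ∈ s.toFinset, (if b = t then 1 else 0) =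
      if b = t then s.toFinset.card else 0 := by
    split_ifs <;> simp
  simp only [Finset.sum_add_distrib] at h
  rw [e1, e2, e3, e4] at h
  set X := ∑ u ∈ s.toFinset with D.Adj b u, ω u
  set Y := ∑ u ∈ s.toFinset with D.Adj u b, ω u
  have hXY : X ≤ Y := by
    by_contra! hlt
    have h1 : ω b * Y + 1 ≤ ω b * X := by nlinarith
    have h2 := Nat.mul_le_mul_left (S.card + 1) h1
    rw [mul_add] at h2
    split_ifs at h <;> omega
  refine ⟨hXY, fun hts => lt_of_le_of_ne hXY fun he => ?_⟩
  have hbt : b ≠ t := by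
    rintro rfl
    have := (List.nodup_append.1 (hnd.of_append_right)).2.2 b hts b (by simp)
    exact this rfl
  rw [he, if_pos hts, if_neg hbt] at h
  omega

open Classical in
/-- The vertices at distance two from the last vertex `f` of a median order outweigh its
out-neighbours; strictly so if `t` is among either and is placed as late as possible. -/
theorem exists_secondOutNbhd_of_medianOrder {f t : V} {l : List V}
    (hasymm : ∀ u v, D.Adj u v → ¬ D.Adj v u)
    (htot : ∀ u ∈ l ++ [f], ∀ v ∈ l ++ [f], u ≠ v → D.Adj u v ∨ D.Adj v u)
    (hnd : (l ++ [f]).Nodup)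
    (hmed : ∀ p s b q, l ++ [f] = p ++ (s ++ b :: q) →
      (∑ u ∈ s.toFinset with D.Adj b u, ω u ≤ ∑ u ∈ s.toFinset with D.Adj u b, ω u) ∧
      (t ∈ s →
        ∑ u ∈ s.toFinset with D.Adj b u, ω u < ∑ u ∈ s.toFinset with D.Adj u b, ω u)) :
    ∃ G ⊆ l.toFinset, (∀ v ∈ G, D.Adj v f ∧ ∃ u ∈ l, D.Adj f u ∧ D.Adj u v) ∧
      (∑ u ∈ l.toFinset with D.Adj f u, ω u ≤ ∑ u ∈ G, ω u) ∧
      (∑ u ∈ l.toFinset with D.Adj f u, ω u < ∑ u ∈ G, ω u ∨ t ∉ l ∨ (t ∉ G ∧ ¬ D.Adj f t)) := by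
  induction hn : l.length using Nat.strong_induction_on generalizing l with
  | _ n ih =>
  -- Let b be the first in-neighbour of f not reached from f through an earlier vertex. Before b,
  -- out-neighbours of f are out-neighbours of b, and in-neighbours of b are in-neighbours of f. So
  -- the median inequality for b over p passes to f, and all in-neighbours of f in p are reached.
  -- Discard b and induct on q.
  by_cases hbad : ∃ k, ∃ p b q, p.length = k ∧ l = p ++ b :: q ∧ D.Adj b f ∧
      ∀ u ∈ p, D.Adj f u → ¬ D.Adj u b
  · obtain ⟨p, b, q, hpk, rfl, hbf, hpb⟩ := Nat.find_spec hbad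
    have hmin : ∀ v ∈ p, D.Adj v f → ∃ u ∈ p, D.Adj f u ∧ D.Adj u v := by
      intro v hv hvf
      obtain ⟨p₁, p₂, rfl⟩ := List.append_of_mem hv
      by_contra! hcon
      refine Nat.find_min hbad (m := p₁.length) (by rw [← hpk]; simp)
        ⟨p₁, v, p₂ ++ b :: q, rfl, by simp, hvf, fun u hu h1 => hcon u (by simp [hu]) h1⟩
    have hnd' := hnd
    simp only [List.append_assoc, List.cons_append, List.nodup_append, List.nodup_cons,
      List.mem_append, List.mem_cons, List.not_mem_nil, or_false] at hnd'
    obtain ⟨hndp, ⟨hbq, hndq, -, hqf⟩, hpq⟩ := hnd'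
    obtain ⟨G, hG, hG2, hGle, hGlt⟩ := ih q.length (by rw [← hn]; simp; omega) (l := q)
      (fun u hu v hv => htot u (by simp at hu ⊢; tauto) v (by simp at hv ⊢; tauto))
      (by
        rw [List.append_assoc] at hnd
        exact (List.nodup_cons.1 hnd.of_append_right).2)
      (fun p' s b' q' h => hmed (p ++ b :: p') s b' q' (by simp [h])) rfl
    obtain ⟨hm1, hm2⟩ := hmed [] p b (q ++ [f]) (by simp)
    have hpf : ∀ u ∈ p, u ≠ f := fun u hu => hpq u hu f (by simp)
    have hpb' : ∀ u ∈ p, u ≠ b := fun u hu => hpq u hu b (by simp)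
    have hdisjq : Disjoint p.toFinset q.toFinset := by
      rw [Finset.disjoint_left]
      intro u hu hu'
      simp only [List.mem_toFinset] at hu hu'
      exact hpq u hu u (by simp [hu']) rfl
    have hle1 : ∑ u ∈ p.toFinset with D.Adj f u, ω u ≤
        ∑ u ∈ p.toFinset with D.Adj b u, ω u := by
      refine Finset.sum_le_sum_of_subset ?_
      intro u
      simp only [Finset.mem_filter, List.mem_toFinset]
      rintro ⟨hu, hfu⟩
      refine ⟨hu, ?_⟩
      rcases htot u (by simp [hu]) b (by simp) (hpb' u hu) with h | h
      · exact absurd h (hpb u hu hfu)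
      · exact h
    have hle2 : ∑ u ∈ p.toFinset with D.Adj u b, ω u ≤
        ∑ u ∈ p.toFinset with D.Adj u f, ω u := by
      refine Finset.sum_le_sum_of_subset ?_
      intro u
      simp only [Finset.mem_filter, List.mem_toFinset]
      rintro ⟨hu, hub⟩
      refine ⟨hu, ?_⟩
      rcases htot u (by simp [hu]) f (by simp) (hpf u hu) with h | h
      · exact h
      · exact absurd hub (hpb u hu h)
    have hsplit : ∑ u ∈ (p ++ b :: q).toFinset with D.Adj f u, ω u =
        ∑ u ∈ p.toFinset with D.Adj f u, ω u + ∑ u ∈ q.toFinset with D.Adj f u, ω u := by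
      rw [← Finset.sum_union (Finset.disjoint_filter_filter hdisjq)]
      refine Finset.sum_congr ?_ fun _ _ => rfl
      ext u
      simp only [Finset.mem_filter, List.mem_toFinset, List.mem_append, List.mem_cons,
        Finset.mem_union]
      constructor
      · rintro ⟨h | rfl | h, h'⟩
        · exact .inl ⟨h, h'⟩
        · exact absurd h' (hasymm _ _ hbf)
        · exact .inr ⟨h, h'⟩
      · tauto
    have hGsum : ∑ u ∈ p.toFinset.filter (D.Adj · f) ∪ G, ω u =
        ∑ u ∈ p.toFinset with D.Adj u f, ω u + ∑ u ∈ G, ω u :=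
      Finset.sum_union (Finset.disjoint_of_subset_left (Finset.filter_subset _ _)
        (Finset.disjoint_of_subset_right hG hdisjq))
    refine ⟨p.toFinset.filter (D.Adj · f) ∪ G, ?_, ?_, ?_, ?_⟩
    · intro u hu
      simp only [Finset.mem_union, Finset.mem_filter, List.mem_toFinset, List.mem_append,
        List.mem_cons] at hu ⊢
      rcases hu with hu | hu
      · exact .inl hu.1
      · exact .inr (.inr (by simpa using hG hu))
    · intro v hv
      simp only [Finset.mem_union, Finset.mem_filter, List.mem_toFinset] at hv
      rcases hv with ⟨hv, hvf⟩ | hv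
      · obtain ⟨u, hu, h⟩ := hmin v hv hvf
        exact ⟨hvf, u, by simp [hu], h⟩
      · obtain ⟨hvf, u, hu, h⟩ := hG2 v hv
        exact ⟨hvf, u, by simp [hu], h⟩
    · rw [hsplit, hGsum]
      omega
    · rw [hsplit, hGsum]
      by_cases htl : t ∈ p ++ b :: q
      · rw [List.mem_append, List.mem_cons] at htl
        rcases htl with h | rfl | h
        · have := hm2 h
          left
          omega
        -- Here t is the discarded vertex b itself.
        · refine .inr (.inr ⟨?_, hasymm _ _ hbf⟩)
          intro h
          simp only [Finset.mem_union, Finset.mem_filter, List.mem_toFinset] at h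
          rcases h with h | h
          · exact hpb' _ h.1 rfl
          · exact hbq (.inl (by simpa using hG h))
        · rcases hGlt with h' | h' | h'
          · left
            omega
          · exact absurd h h'
          · refine .inr (.inr ⟨?_, h'.2⟩)
            intro h''
            simp only [Finset.mem_union, Finset.mem_filter, List.mem_toFinset] at h''
            rcases h'' with h'' | h''
            · exact hpq t h''.1 t (by simp [h]) rfl
            · exact h'.1 h''
      · exact .inr (.inl htl)
  -- Every in-neighbour of f is reached, so the median inequality for f suffices.
  · obtain ⟨hm1, hm2⟩ := hmed [] l f [] (by simp)
    refine ⟨l.toFinset.filter (D.Adj · f), Finset.filter_subset _ _, ?_, hm1, ?_⟩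
    · intro v hv
      simp only [Finset.mem_filter, List.mem_toFinset] at hv
      obtain ⟨p, q, rfl⟩ := List.append_of_mem hv.1
      refine ⟨hv.2, ?_⟩
      by_contra! hcon
      exact hbad ⟨_, p, v, q, rfl, rfl, hv.2, fun u hu h => hcon u (by simp [hu]) h⟩
    · by_cases h : t ∈ l
      · exact .inl (hm2 h)
      · exact .inr (.inl h)

/-- The last vertex of a median order works; the tie-breaking vertex t is arbitrary here. -/
theorem exists_hasWeightedSNP (hirr : ∀ v, ¬ D.Adj v v)
    (hasymm : ∀ u v, D.Adj u v → ¬ D.Adj v u)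
    (htot : ∀ u ∈ S, ∀ v ∈ S, u ≠ v → D.Adj u v ∨ D.Adj v u)
    (hω : ∀ v ∈ S, 1 ≤ ω v) (hS : S.Nonempty) :
    ∃ f ∈ S, D.HasWeightedSNP S ω f := by
  classical
  obtain ⟨t, ht⟩ := hS
  obtain ⟨l, hnd, rfl, hmed⟩ := exists_medianOrder (D := D) hω t
  rcases l.eq_nil_or_concat with rfl | ⟨l, f, rfl⟩
  · simp at ht
  rw [List.concat_eq_append] at *
  obtain ⟨G, hG, hG2, hGle, -⟩ := exists_secondOutNbhd_of_medianOrder hasymm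
    (fun u hu v hv => htot u (List.mem_toFinset.2 hu) v (List.mem_toFinset.2 hv)) hnd hmed
  refine ⟨f, by simp, ?_⟩
  unfold HasWeightedSNP
  calc _ = ∑ u ∈ l.toFinset with D.Adj f u, ω u := by
        refine Finset.sum_congr ?_ fun _ _ => rfl
        ext u
        simp only [Finset.mem_filter, List.mem_toFinset, List.mem_append, List.mem_singleton]
        constructor
        · rintro ⟨h | rfl, h'⟩
          · exact ⟨h, h'⟩
          · exact absurd h' (hirr _)
        · tauto
    _ ≤ _ := hGle
    _ ≤ _ := by
        refine Finset.sum_le_sum_of_subset ?_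
        intro v hv
        obtain ⟨hvf, u, hu, h⟩ := hG2 v hv
        have hvl := hG hv
        simp only [Finset.mem_filter, List.mem_toFinset, List.mem_append,
          List.mem_singleton] at hvl ⊢
        refine ⟨.inl hvl, ?_, hasymm _ _ hvf, u, .inl hu, h⟩
        rintro rfl
        exact hirr _ hvf

/-- Delete v and take the last vertex f of a median order of the rest that puts t as late as
possible. Restoring v can add at most its weight 1 to the out-neighbourhood of f. That loss is
covered by a strict inequality or by t, newly reached along f → v → t. -/
theorem exists_ne_hasWeightedSNP (hirr : ∀ v, ¬ D.Adj v v)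
    (hasymm : ∀ u v, D.Adj u v → ¬ D.Adj v u)
    (htot : ∀ u ∈ S, ∀ v ∈ S, u ≠ v → D.Adj u v ∨ D.Adj v u)
    (hω : ∀ v ∈ S, 1 ≤ ω v) {v t : V} (hv : v ∈ S) (hωv : ω v = 1) (ht : t ∈ S)
    (hvt : D.Adj v t) :
    ∃ f ∈ S, f ≠ v ∧ D.HasWeightedSNP S ω f := by
  classical
  have htv : t ≠ v := by
    rintro rfl
    exact hirr _ hvt
  obtain ⟨l, hnd, hl, hmed⟩ := exists_medianOrder (D := D) (S := S.erase v)
    (fun u hu => hω u (Finset.mem_of_mem_erase hu)) t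
  have hmem : ∀ u, u ∈ l ↔ u ≠ v ∧ u ∈ S := fun u => by
    rw [← List.mem_toFinset, hl, Finset.mem_erase]
  rcases l.eq_nil_or_concat with rfl | ⟨l, f, rfl⟩
  · exact absurd ((hmem t).2 ⟨htv, ht⟩) (by simp)
  rw [List.concat_eq_append] at *
  obtain ⟨G, hG, hG2, hGle, hGlt⟩ := exists_secondOutNbhd_of_medianOrder hasymm
    (fun u hu w hw => htot u ((hmem u).1 hu).2 w ((hmem w).1 hw).2) hnd hmed
  obtain ⟨hfv, hfS⟩ := (hmem f).1 (by simp)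
  have hlS : ∀ u ∈ l, u ≠ v ∧ u ∈ S := fun u hu => (hmem u).1 (by simp [hu])
  refine ⟨f, hfS, hfv, ?_⟩
  unfold HasWeightedSNP
  set N := S.filter fun w => w ≠ f ∧ ¬ D.Adj f w ∧ ∃ u ∈ S, D.Adj f u ∧ D.Adj u w with hN
  have hGN : G ⊆ N := by
    intro w hw
    obtain ⟨hwf, u, hu, h⟩ := hG2 w hw
    have hwl := hG hw
    rw [List.mem_toFinset] at hwl
    rw [hN, Finset.mem_filter]
    refine ⟨(hlS w hwl).2, ?_, hasymm _ _ hwf, u, (hlS u hu).2, h⟩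
    rintro rfl
    exact hirr _ hwf
  have hGN' := Finset.sum_le_sum_of_subset (f := ω) hGN
  have hadj : ∀ w ∈ S, D.Adj f w → w ≠ v → w ∈ l := by
    intro w hw hfw hwv
    have h := (hmem w).2 ⟨hwv, hw⟩
    simp only [List.mem_append, List.mem_singleton] at h
    rcases h with h | rfl
    · exact h
    · exact absurd hfw (hirr _)
  by_cases hfv' : D.Adj f v
  · have hout : ∑ w ∈ S with D.Adj f w, ω w ≤
        ∑ u ∈ l.toFinset with D.Adj f u, ω u + 1 := by
      rw [← hωv, add_comm, ← Finset.sum_insert (by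
        simp only [Finset.mem_filter, List.mem_toFinset]
        exact fun h => (hlS v h.1).1 rfl)]
      refine Finset.sum_le_sum_of_subset ?_
      intro w
      simp only [Finset.mem_filter, Finset.mem_insert, List.mem_toFinset]
      rintro ⟨h1, h2⟩
      by_cases h : w = v
      · exact .inl h
      · exact .inr ⟨hadj w h1 h2 h, h2⟩
    -- Either there is slack 1, or t = f, contradicting f → v → t, or t is a new second
    -- out-neighbour of weight at least 1.
    rcases hGlt with h | h | ⟨h1, h2⟩
    · omega
    · have : t = f := by
        have := (hmem t).2 ⟨htv, ht⟩
        simpa [h] using this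
      exact absurd hfv' (hasymm _ _ (this ▸ hvt))
    · have htN : t ∈ N := by
        rw [hN, Finset.mem_filter]
        refine ⟨ht, ?_, h2, v, hv, hfv', hvt⟩
        rintro rfl
        exact hasymm _ _ hvt hfv'
      have h3 := Finset.sum_le_sum_of_subset (f := ω)
        (Finset.insert_subset htN hGN)
      rw [Finset.sum_insert h1] at h3
      have := hω t ht
      omega
  · refine le_trans (Finset.sum_le_sum_of_subset ?_) (hGle.trans hGN')
    intro w
    simp only [Finset.mem_filter, List.mem_toFinset]
    rintro ⟨h1, h2⟩
    refine ⟨hadj w h1 h2 ?_, h2⟩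
    rintro rfl
    exact hfv' h2

end Digraph

/-! ### Arcs forced inside and around the stars. -/

theorem StarGraph.mk_mem_edges {V : Type*} {S : StarGraph V} {u v : V} :
    s(u, v) ∈ S.edges ↔ u = S.center ∧ v ∈ S.leaves ∨ v = S.center ∧ u ∈ S.leaves := by
  simp only [StarGraph.edges, Set.mem_ofPred_eq, Sym2.eq_iff]
  constructor
  · rintro ⟨a, ha, ⟨rfl, rfl⟩ | ⟨rfl, rfl⟩⟩
    · exact .inl ⟨rfl, ha⟩
    · exact .inr ⟨rfl, ha⟩
  · rintro (⟨rfl, h⟩ | ⟨rfl, h⟩)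
    · exact ⟨v, h, .inl ⟨rfl, rfl⟩⟩
    · exact ⟨u, h, .inr ⟨rfl, rfl⟩⟩

namespace Digraph

variable {V : Type*} {D : Digraph V} {X Y Z : StarGraph V}

/-- `D` is a tournament missing the three disjoint stars `X`, `Y`, `Z`, whose centres form a
directed triangle. -/
structure MissesTriangleOfStars (D : Digraph V) (X Y Z : StarGraph V) : Prop where
  irrefl : ∀ v, ¬ D.Adj v v
  asymm : ∀ u v, D.Adj u v → ¬ D.Adj v u
  disjoint_XY : ∀ v ∈ X.verts, v ∉ Y.verts
  disjoint_YZ : ∀ v ∈ Y.verts, v ∉ Z.verts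
  disjoint_ZX : ∀ v ∈ Z.verts, v ∉ X.verts
  adj_or : ∀ u v, u ≠ v → s(u, v) ∉ X.edges → s(u, v) ∉ Y.edges → s(u, v) ∉ Z.edges →
    D.Adj u v ∨ D.Adj v u
  not_adj_X : ∀ a ∈ X.leaves, ¬ D.Adj X.center a ∧ ¬ D.Adj a X.center
  not_adj_Y : ∀ a ∈ Y.leaves, ¬ D.Adj Y.center a ∧ ¬ D.Adj a Y.center
  not_adj_Z : ∀ a ∈ Z.leaves, ¬ D.Adj Z.center a ∧ ¬ D.Adj a Z.center
  adj_XY : D.Adj X.center Y.center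
  adj_YZ : D.Adj Y.center Z.center
  adj_ZX : D.Adj Z.center X.center

namespace MissesTriangleOfStars

theorem rotate (h : D.MissesTriangleOfStars X Y Z) : D.MissesTriangleOfStars Y Z X where
  irrefl := h.irrefl
  asymm := h.asymm
  disjoint_XY := h.disjoint_YZ
  disjoint_YZ := h.disjoint_ZX
  disjoint_ZX := h.disjoint_XY
  adj_or u v huv h1 h2 h3 := h.adj_or u v huv h3 h1 h2
  not_adj_X := h.not_adj_Y
  not_adj_Y := h.not_adj_Z
  not_adj_Z := h.not_adj_X
  adj_XY := h.adj_YZ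
  adj_YZ := h.adj_ZX
  adj_ZX := h.adj_XY

/-- The centre of `X` has no arc to its own star, which excludes f in `X`. It has no arc to the
centre of `Z` but reaches it in two steps, which excludes f in `Z`. For f in `Y`, the arc between
the centres leaves one way to match the ends. -/
theorem losesTo (h : D.MissesTriangleOfStars X Y Z) {a : V} {f : Sym2 V}
    (hf : f ∈ X.edges ∨ f ∈ Y.edges ∨ f ∈ Z.edges) (hl : D.LosesTo s(X.center, a) f) :
    ∃ b ∈ Y.leaves, f = s(Y.center, b) ∧ D.Adj a b ∧
      b ∉ D.outNbhd X.center ∪ D.secondOutNbhd X.center ∧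
      Y.center ∉ D.outNbhd a ∪ D.secondOutNbhd a := by
  have h2 : Z.center ∈ D.outNbhd X.center ∪ D.secondOutNbhd X.center := by
    refine .inr ⟨?_, h.asymm _ _ h.adj_ZX, Y.center, h.adj_XY, h.adj_YZ⟩
    intro he
    have := h.adj_ZX
    rw [he] at this
    exact h.irrefl _ this
  obtain ⟨x₁, y₁, x₂, y₂, he, rfl, h11, h12, h21, h22⟩ := hl
  simp only [StarGraph.mk_mem_edges] at hf
  rcases Sym2.eq_iff.1 he with ⟨rfl, rfl⟩ | ⟨rfl, rfl⟩ <;>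
  rcases hf with (⟨rfl, hf⟩ | ⟨rfl, hf⟩) | (⟨rfl, hf⟩ | ⟨rfl, hf⟩) | (⟨rfl, hf⟩ | ⟨rfl, hf⟩)
  · exact absurd h11 (h.irrefl _)
  · exact absurd h11 (h.not_adj_X _ hf).1
  · exact ⟨y₂, hf, rfl, h21, h12, h22⟩
  · exact absurd (.inl h.adj_XY) h12
  · exact absurd h11 (h.asymm _ _ h.adj_ZX)
  · exact absurd h2 h12
  · exact absurd h21 (h.not_adj_X _ hf).1
  · exact absurd h21 (h.irrefl _)
  · exact absurd (.inl h.adj_XY) h22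
  · exact ⟨x₂, hf, Sym2.eq_swap, h11, h22, h12⟩
  · exact absurd h2 h22
  · exact absurd h21 (h.asymm _ _ h.adj_ZX)

end MissesTriangleOfStars

/-- Moreover every missing edge loses to one and is lost to by one. -/
structure MissesDependentStars (D : Digraph V) (X Y Z : StarGraph V) : Prop
    extends D.MissesTriangleOfStars X Y Z where
  exists_losesTo : ∀ e, e ∈ X.edges ∨ e ∈ Y.edges ∨ e ∈ Z.edges →
    ∃ f, (f ∈ X.edges ∨ f ∈ Y.edges ∨ f ∈ Z.edges) ∧ D.LosesTo e f
  exists_losesTo_left : ∀ f, f ∈ X.edges ∨ f ∈ Y.edges ∨ f ∈ Z.edges →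
    ∃ e, (e ∈ X.edges ∨ e ∈ Y.edges ∨ e ∈ Z.edges) ∧ D.LosesTo e f

namespace MissesDependentStars

theorem rotate (h : D.MissesDependentStars X Y Z) : D.MissesDependentStars Y Z X where
  toMissesTriangleOfStars := h.toMissesTriangleOfStars.rotate
  exists_losesTo e he := by
    obtain ⟨f, hf, hl⟩ := h.exists_losesTo e (by tauto)
    exact ⟨f, by tauto, hl⟩
  exists_losesTo_left e he := by
    obtain ⟨f, hf, hl⟩ := h.exists_losesTo_left e (by tauto)
    exact ⟨f, by tauto, hl⟩

theorem exists_adj_of_mem_X (h : D.MissesDependentStars X Y Z) {a : V} (ha : a ∈ X.leaves) :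
    ∃ b ∈ Y.leaves, D.Adj a b ∧ Y.center ∉ D.outNbhd a ∪ D.secondOutNbhd a := by
  obtain ⟨f, hf, hl⟩ := h.exists_losesTo s(X.center, a) (.inl ⟨a, ha, rfl⟩)
  obtain ⟨b, hb, -, hab, -, h2⟩ := h.losesTo hf hl
  exact ⟨b, hb, hab, h2⟩

/-- Positive in-degree in Δ enters here: the edge losing to the one at b must come from `X`, since
edges of `Y` and `Z` lose only to edges of `Z` and `X`. -/
theorem notMem_of_mem_Y (h : D.MissesDependentStars X Y Z) {b : V} (hb : b ∈ Y.leaves) :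
    b ∉ D.outNbhd X.center ∪ D.secondOutNbhd X.center := by
  obtain ⟨e, he, hl⟩ := h.exists_losesTo_left s(Y.center, b) (.inr (.inl ⟨b, hb, rfl⟩))
  have hf : s(Y.center, b) ∈ X.edges ∨ s(Y.center, b) ∈ Y.edges ∨ s(Y.center, b) ∈ Z.edges :=
    .inr (.inl ⟨b, hb, rfl⟩)
  have hYb : Y.center ≠ b := by
    rintro rfl
    exact Y.center_notMem hb
  rcases he with ⟨a, ha, rfl⟩ | ⟨a, ha, rfl⟩ | ⟨a, ha, rfl⟩
  · obtain ⟨b', hb', he, -, h1, -⟩ := h.losesTo hf hl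
    rcases Sym2.eq_iff.1 he with ⟨-, rfl⟩ | ⟨he, he'⟩
    · exact h1
    · exact absurd he'.symm hYb
  · obtain ⟨b', hb', he, -⟩ := h.rotate.losesTo (by tauto) hl
    rcases Sym2.eq_iff.1 he with ⟨he, -⟩ | ⟨he, -⟩
    · exact absurd (.inl he) (h.disjoint_YZ _ (.inl rfl))
    · exact absurd (.inr (he ▸ hb')) (h.disjoint_YZ _ (.inl rfl))
  · obtain ⟨b', hb', he, -⟩ := h.rotate.rotate.losesTo (by tauto) hl
    rcases Sym2.eq_iff.1 he with ⟨he, -⟩ | ⟨he, -⟩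
    · exact absurd (.inl rfl) (h.disjoint_XY _ (.inl he))
    · exact absurd (.inl rfl) (h.disjoint_XY Y.center (.inr (he ▸ hb')))

theorem adj_Y_center (h : D.MissesDependentStars X Y Z) {a : V} (ha : a ∈ X.leaves) :
    D.Adj Y.center a := by
  obtain ⟨b, hb, hab, h2⟩ := h.exists_adj_of_mem_X ha
  have h2' := h.disjoint_XY a (.inr ha)
  have h3 := fun h' => h.disjoint_ZX a h' (.inr ha)
  have h4 := fun h' => h.disjoint_XY Y.center h' (.inl rfl)
  have h5 := h.disjoint_YZ Y.center (.inl rfl)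
  simp only [StarGraph.verts, Set.mem_insert_iff, not_or] at h2' h3 h4 h5
  rcases h.adj_or Y.center a (fun h' => h2'.1 h'.symm)
    (by rw [StarGraph.mk_mem_edges]; tauto) (by rw [StarGraph.mk_mem_edges]; tauto)
    (by rw [StarGraph.mk_mem_edges]; tauto) with h' | h'
  · exact h'
  · exact absurd (.inl h') h2

theorem adj_X_center (h : D.MissesDependentStars X Y Z) {b : V} (hb : b ∈ Y.leaves) :
    D.Adj b X.center := by
  have h2 := h.notMem_of_mem_Y hb
  have h2' := fun h' => h.disjoint_XY b h' (.inr hb)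
  have h3 := h.disjoint_YZ b (.inr hb)
  have h4 := h.disjoint_XY X.center (.inl rfl)
  have h5 := fun h' => h.disjoint_ZX X.center h' (.inl rfl)
  simp only [StarGraph.verts, Set.mem_insert_iff, not_or] at h2' h3 h4 h5
  rcases h.adj_or X.center b (fun h' => h2' (.inl h'.symm))
    (by rw [StarGraph.mk_mem_edges]; tauto) (by rw [StarGraph.mk_mem_edges]; tauto)
    (by rw [StarGraph.mk_mem_edges]; tauto) with h' | h'
  · exact absurd (.inl h') h2
  · exact h'

/-- Otherwise z → b → a would make a a second out-neighbour of z, the centre of `Z`. -/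
theorem adj_leaves (h : D.MissesDependentStars X Y Z) {a b : V} (ha : a ∈ X.leaves)
    (hb : b ∈ Y.leaves) : D.Adj a b := by
  have hzb := h.rotate.adj_Y_center hb
  have haz := h.rotate.rotate.adj_X_center ha
  have h1 := h.rotate.rotate.notMem_of_mem_Y ha
  have h2 := h.disjoint_XY a (.inr ha)
  have h3 := fun h' => h.disjoint_XY b h' (.inr hb)
  have h4 := h.disjoint_YZ b (.inr hb)
  simp only [StarGraph.verts, Set.mem_insert_iff, not_or] at h2 h3 h4
  rcases h.adj_or a b (by rintro rfl; exact h2.2 hb)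
    (by rw [StarGraph.mk_mem_edges]; tauto) (by rw [StarGraph.mk_mem_edges]; tauto)
    (by rw [StarGraph.mk_mem_edges]; tauto) with h' | h'
  · exact h'
  · refine absurd (.inr ⟨?_, h.asymm _ _ haz, b, hzb, h'⟩) h1
    rintro rfl
    exact h.irrefl _ haz

theorem adj_or_of_notMem (h : D.MissesDependentStars X Y Z) {u w : V}
    (hX : w ∉ X.verts) (hY : w ∉ Y.verts) (hZ : w ∉ Z.verts) (huw : u ≠ w) :
    D.Adj u w ∨ D.Adj w u := by
  simp only [StarGraph.verts, Set.mem_insert_iff, not_or] at hX hY hZ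
  refine h.adj_or u w huw ?_ ?_ ?_ <;> rw [StarGraph.mk_mem_edges] <;> tauto

/-- Otherwise the path through w would put b in the second out-neighbourhood of the centre of `X`.
-/
theorem adj_of_X_center (h : D.MissesDependentStars X Y Z) {b w : V} (hb : b ∈ Y.leaves)
    (hX : w ∉ X.verts) (hY : w ∉ Y.verts) (hZ : w ∉ Z.verts) (hw : D.Adj X.center w) :
    D.Adj b w := by
  rcases h.adj_or_of_notMem (u := b) hX hY hZ (by rintro rfl; exact hY (.inr hb)) with h' | h'
  · exact h'
  · have hbx := h.adj_X_center hb
    refine absurd (.inr ⟨?_, h.asymm _ _ hbx, w, hw, h'⟩) (h.notMem_of_mem_Y hb)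
    rintro rfl
    exact h.irrefl _ hbx

theorem Y_center_adj (h : D.MissesDependentStars X Y Z) {a w : V} (ha : a ∈ X.leaves)
    (hX : w ∉ X.verts) (hY : w ∉ Y.verts) (hZ : w ∉ Z.verts) (hw : D.Adj a w) :
    D.Adj Y.center w := by
  rcases h.adj_or_of_notMem (u := Y.center) hX hY hZ (by rintro rfl; exact hY (.inl rfl))
    with h' | h'
  · exact h'
  · have hya := h.adj_Y_center ha
    obtain ⟨b, -, -, h2⟩ := h.exists_adj_of_mem_X ha
    refine absurd (.inr ⟨?_, h.asymm _ _ hya, w, hw, h'⟩) h2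
    intro he
    rw [he] at hya
    exact h.irrefl _ hya

theorem leaves_nonempty_of_leaves_nonempty (h : D.MissesDependentStars X Y Z)
    (hX : X.leaves.Nonempty) : Y.leaves.Nonempty := by
  obtain ⟨a, ha⟩ := hX
  obtain ⟨b, hb, -⟩ := h.exists_adj_of_mem_X ha
  exact ⟨b, hb⟩

/-- The vertices of the three stars all have the same out-neighbours elsewhere. -/
theorem adj_iff_adj_X_center (h : D.MissesDependentStars X Y Z) (hne : X.leaves.Nonempty)
    {u w : V} (hu : u ∈ X.verts ∨ u ∈ Y.verts ∨ u ∈ Z.verts)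
    (hX : w ∉ X.verts) (hY : w ∉ Y.verts) (hZ : w ∉ Z.verts) :
    D.Adj u w ↔ D.Adj X.center w := by
  obtain ⟨a, ha⟩ := hne
  obtain ⟨b, hb⟩ := h.leaves_nonempty_of_leaves_nonempty ⟨a, ha⟩
  obtain ⟨c, hc⟩ := h.rotate.leaves_nonempty_of_leaves_nonempty ⟨b, hb⟩
  -- The six implications close the cycle x, B, z, A, y, C, x. Passing from one centre to the next
  -- needs a leaf in between.
  have h1 : ∀ b ∈ Y.leaves, D.Adj X.center w → D.Adj b w :=
    fun b hb => h.adj_of_X_center hb hX hY hZ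
  have h2 : ∀ b ∈ Y.leaves, D.Adj b w → D.Adj Z.center w :=
    fun b hb => h.rotate.Y_center_adj hb hY hZ hX
  have h3 : ∀ a ∈ X.leaves, D.Adj Z.center w → D.Adj a w :=
    fun a ha => h.rotate.rotate.adj_of_X_center ha hZ hX hY
  have h4 : ∀ a ∈ X.leaves, D.Adj a w → D.Adj Y.center w :=
    fun a ha => h.Y_center_adj ha hX hY hZ
  have h5 : ∀ c ∈ Z.leaves, D.Adj Y.center w → D.Adj c w :=
    fun c hc => h.rotate.adj_of_X_center hc hY hZ hX
  have h6 : ∀ c ∈ Z.leaves, D.Adj c w → D.Adj X.center w :=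
    fun c hc => h.rotate.rotate.Y_center_adj hc hZ hX hY
  have k1 := fun h' => h2 b hb (h1 b hb h')
  have k2 := fun h' => h4 a ha (h3 a ha h')
  have k3 := fun h' => h6 c hc (h5 c hc h')
  rcases hu with (rfl | hu) | (rfl | hu) | (rfl | hu)
  · rfl
  · exact ⟨fun h' => k3 (h4 u hu h'), fun h' => h3 u hu (k1 h')⟩
  · exact ⟨k3, fun h' => k2 (k1 h')⟩
  · exact ⟨fun h' => k3 (k2 (h2 u hu h')), h1 u hu⟩
  · exact ⟨fun h' => k3 (k2 h'), k1⟩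
  · exact ⟨h6 u hu, fun h' => h5 u hu (k2 (k1 h'))⟩

end MissesDependentStars

/-! ### Two vertices with the property inside the stars. -/

theorem hasWeightedSNP_one_iff {S : Finset V} {v : V} :
    D.HasWeightedSNP S (fun _ => 1) v ↔ {w | w ∈ S ∧ D.Adj v w}.encard ≤
      {w | w ∈ S ∧ w ≠ v ∧ ¬ D.Adj v w ∧ ∃ u ∈ S, D.Adj v u ∧ D.Adj u w}.encard := by
  classical
  have h : ∀ p : V → Prop, {w | w ∈ S ∧ p w}.encard = (S.filter p).card := by
    intro p
    rw [← Set.encard_coe_eq_coe_finsetCard]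
    congr 1
    ext
    simp
  rw [h, h, Nat.cast_le]
  simp [HasWeightedSNP]

namespace MissesDependentStars

/-- If the vertex set `K` of the stars has at most as many out-neighbours as second
out-neighbours outside `K`, and `Z` has at most as many leaves as `X`, then the centre of `X`
and a leaf of `Y` have the second neighbourhood property. -/
theorem exists_hasSNP_of_encard_le [Finite V] (h : D.MissesDependentStars X Y Z)
    (hne : Y.leaves.Nonempty) (hle : Z.leaves.encard ≤ X.leaves.encard) {K P Q : Set V}
    (hK : ∀ v, v ∈ K ↔ v ∈ X.verts ∨ v ∈ Y.verts ∨ v ∈ Z.verts)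
    (hP : ∀ u ∈ K, ∀ w ∉ K, D.Adj u w ↔ w ∈ P) (hPK : ∀ w ∈ P, w ∉ K)
    (hQK : ∀ w ∈ Q, w ∉ K) (hQP : ∀ w ∈ Q, w ∉ P) (hQ : ∀ w ∈ Q, ∃ u ∈ P, D.Adj u w)
    (hPQ : P.encard ≤ Q.encard) :
    ∃ u v : V, u ≠ v ∧ D.HasSNP u ∧ D.HasSNP v := by
  have hQout : ∀ u ∈ K, ∀ w ∈ Q, w ∈ D.secondOutNbhd u := by
    intro u hu w hw
    refine ⟨?_, fun h' => hQP w hw ((hP u hu w (hQK w hw)).1 h'), ?_⟩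
    · rintro rfl
      exact hQK _ hw hu
    · obtain ⟨p, hp, hpw⟩ := hQ w hw
      exact ⟨p, (hP u hu p (hPK p hp)).2 hp, hpw⟩
  have hxK : X.center ∈ K := (hK _).2 (.inl (.inl rfl))
  have hyK : Y.center ∈ K := (hK _).2 (.inr (.inl (.inl rfl)))
  have hzK : Z.center ∈ K := (hK _).2 (.inr (.inr (.inl rfl)))
  have hAK : ∀ a ∈ X.leaves, a ∈ K := fun a ha => (hK _).2 (.inl (.inr ha))
  have hBK : ∀ a ∈ Y.leaves, a ∈ K := fun a ha => (hK _).2 (.inr (.inl (.inr ha)))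
  have hCK : ∀ a ∈ Z.leaves, a ∈ K := fun a ha => (hK _).2 (.inr (.inr (.inr ha)))
  have hcases : ∀ w ∈ K, w = X.center ∨ w ∈ X.leaves ∨ w = Y.center ∨ w ∈ Y.leaves ∨
      w = Z.center ∨ w ∈ Z.leaves := by
    intro w hw
    rw [hK] at hw
    simp only [StarGraph.verts, Set.mem_insert_iff] at hw
    tauto
  have hxC : ∀ c ∈ Z.leaves, D.Adj X.center c := fun c hc => h.rotate.rotate.adj_Y_center hc
  have hAz : ∀ a ∈ X.leaves, D.Adj a Z.center := fun a ha => h.rotate.rotate.adj_X_center ha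
  have hzB : ∀ b ∈ Y.leaves, D.Adj Z.center b := fun b hb => h.rotate.adj_Y_center hb
  have hBx : ∀ b ∈ Y.leaves, D.Adj b X.center := fun b hb => h.adj_X_center hb
  have hAB : ∀ a ∈ X.leaves, ∀ b ∈ Y.leaves, D.Adj a b := fun a ha b hb => h.adj_leaves ha hb
  have hBC : ∀ b ∈ Y.leaves, ∀ c ∈ Z.leaves, D.Adj b c :=
    fun b hb c hc => h.rotate.adj_leaves hb hc
  have hCA : ∀ c ∈ Z.leaves, ∀ a ∈ X.leaves, D.Adj c a :=
    fun c hc a ha => h.rotate.rotate.adj_leaves hc ha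
  have hC : Z.leaves.Nonempty := h.rotate.leaves_nonempty_of_leaves_nonempty hne
  obtain ⟨c, hc⟩ := hC
  -- Inside K the centre x has out-neighbours y and C, and reaches z through y and A through any c
  -- in C.
  have hx : D.HasSNP X.center := by
    have h1 : D.outNbhd X.center ⊆ ({Y.center} ∪ Z.leaves) ∪ P := by
      intro w hw
      change D.Adj X.center w at hw
      by_cases hwK : w ∈ K
      · left
        rcases hcases w hwK with rfl | h' | rfl | h' | rfl | h'
        · exact absurd hw (h.irrefl _)
        · exact absurd hw (h.not_adj_X _ h').1
        · exact .inl rfl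
        · exact absurd hw (h.asymm _ _ (hBx _ h'))
        · exact absurd hw (h.asymm _ _ h.adj_ZX)
        · exact .inr h'
      · exact .inr ((hP _ hxK w hwK).1 hw)
    have h2 : ({Z.center} ∪ X.leaves) ∪ Q ⊆ D.secondOutNbhd X.center := by
      rintro w ((hw | hw) | hw)
      · obtain rfl : w = Z.center := hw
        refine ⟨?_, h.asymm _ _ h.adj_ZX, _, h.adj_XY, h.adj_YZ⟩
        intro he
        have := h.adj_ZX
        rw [he] at this
        exact h.irrefl _ this
      · refine ⟨?_, (h.not_adj_X w hw).1, c, hxC c hc, hCA c hc w hw⟩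
        rintro rfl
        exact X.center_notMem hw
      · exact hQout _ hxK w hw
    have h3 : Disjoint ({Z.center} ∪ X.leaves) Q := by
      rw [Set.disjoint_left]
      rintro w (hw | hw) hwQ
      · obtain rfl : w = Z.center := hw
        exact hQK _ hwQ hzK
      · exact hQK _ hwQ (hAK _ hw)
    have h4 : Disjoint {Z.center} X.leaves := by
      rw [Set.disjoint_singleton_left]
      intro hz
      exact h.irrefl _ (hAz _ hz)
    calc D.outDegree X.center ≤ (({Y.center} ∪ Z.leaves) ∪ P).encard := Set.encard_le_encard h1
      _ ≤ (1 + Z.leaves.encard) + P.encard := by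
        refine (Set.encard_union_le _ _).trans (add_le_add_left ?_ _)
        exact (Set.encard_union_le _ _).trans (by rw [Set.encard_singleton])
      _ ≤ (1 + X.leaves.encard) + Q.encard := by gcongr
      _ = (({Z.center} ∪ X.leaves) ∪ Q).encard := by
        rw [Set.encard_union_eq h3, Set.encard_union_eq h4, Set.encard_singleton]
      _ ≤ D.secondOutDegree X.center := Set.encard_le_encard h2
  -- The leaves of `Y` span a tournament. Choosing b with the SNP there balances the part of its
  -- neighbourhood inside B.
  obtain ⟨b, hb, hbsnp⟩ := exists_hasWeightedSNP (D := D) (S := Y.leaves.toFinite.toFinset)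
    (ω := fun _ => 1) h.irrefl h.asymm (by
      intro u hu v hv huv
      simp only [Set.Finite.mem_toFinset] at hu hv
      have h1 := fun h' => h.disjoint_XY u h' (.inr hu)
      have h2 := h.disjoint_YZ u (.inr hu)
      have h3 : ∀ v ∈ Y.leaves, v ≠ Y.center := by
        rintro v hv rfl
        exact Y.center_notMem hv
      have h4 := h3 u hu
      have h5 := h3 v hv
      have h6 := fun h' => h.disjoint_XY v h' (.inr hv)
      have h7 := h.disjoint_YZ v (.inr hv)
      simp only [StarGraph.verts, Set.mem_insert_iff, not_or] at h1 h2 h6 h7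
      refine h.adj_or u v huv ?_ ?_ ?_ <;> rw [StarGraph.mk_mem_edges] <;> tauto)
    (fun _ _ => le_rfl) (by simpa using hne)
  rw [hasWeightedSNP_one_iff] at hbsnp
  simp only [Set.Finite.mem_toFinset] at hb hbsnp
  set N₁ := {w | w ∈ Y.leaves ∧ D.Adj b w} with hN₁
  set N₂ := {w | w ∈ Y.leaves ∧ w ≠ b ∧ ¬ D.Adj b w ∧ ∃ u ∈ Y.leaves, D.Adj b u ∧ D.Adj u w}
    with hN₂
  have hb' : D.HasSNP b := by
    have h1 : D.outNbhd b ⊆ (({X.center} ∪ Z.leaves) ∪ N₁) ∪ P := by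
      intro w hw
      change D.Adj b w at hw
      by_cases hwK : w ∈ K
      · left
        rcases hcases w hwK with rfl | h' | rfl | h' | rfl | h'
        · exact .inl (.inl rfl)
        · exact absurd hw (h.asymm _ _ (hAB _ h' _ hb))
        · exact absurd hw (h.not_adj_Y _ hb).2
        · exact .inr ⟨h', hw⟩
        · exact absurd hw (h.asymm _ _ (hzB _ hb))
        · exact .inl (.inr h')
      · exact .inr ((hP _ (hBK b hb) w hwK).1 hw)
    have h2 : (({Y.center} ∪ X.leaves) ∪ N₂) ∪ Q ⊆ D.secondOutNbhd b := by
      rintro w (((hw | hw) | hw) | hw)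
      · obtain rfl : w = Y.center := hw
        refine ⟨?_, (h.not_adj_Y _ hb).2, _, hBx b hb, h.adj_XY⟩
        rintro rfl
        exact Y.center_notMem hb
      · refine ⟨?_, h.asymm _ _ (hAB w hw b hb), c, hBC b hb c hc, hCA c hc w hw⟩
        rintro rfl
        exact h.irrefl _ (hAB w hw w hb)
      · obtain ⟨-, h1, h2, u, -, h3⟩ := hw
        exact ⟨h1, h2, u, h3⟩
      · exact hQout _ (hBK b hb) w hw
    have h3 : Disjoint (({Y.center} ∪ X.leaves) ∪ N₂) Q := by
      rw [Set.disjoint_left]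
      rintro w ((hw | hw) | hw) hwQ
      · obtain rfl : w = Y.center := hw
        exact hQK _ hwQ hyK
      · exact hQK _ hwQ (hAK _ hw)
      · exact hQK _ hwQ (hBK _ hw.1)
    have h4 : Disjoint ({Y.center} ∪ X.leaves) N₂ := by
      rw [Set.disjoint_left]
      rintro w (hw | hw) hwN
      · obtain rfl : w = Y.center := hw
        exact Y.center_notMem hwN.1
      · exact h.irrefl _ (hAB w hw w hwN.1)
    have h5 : Disjoint {Y.center} X.leaves := by
      rw [Set.disjoint_singleton_left]
      intro hz
      exact h.disjoint_XY _ (.inr hz) (.inl rfl)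
    calc D.outDegree b ≤ ((({X.center} ∪ Z.leaves) ∪ N₁) ∪ P).encard := Set.encard_le_encard h1
      _ ≤ ((1 + Z.leaves.encard) + N₁.encard) + P.encard := by
        refine (Set.encard_union_le _ _).trans (add_le_add_left ?_ _)
        refine (Set.encard_union_le _ _).trans (add_le_add_left ?_ _)
        exact (Set.encard_union_le _ _).trans (by rw [Set.encard_singleton])
      _ ≤ ((1 + X.leaves.encard) + N₂.encard) + Q.encard := by gcongr
      _ = ((({Y.center} ∪ X.leaves) ∪ N₂) ∪ Q).encard := by
        rw [Set.encard_union_eq h3, Set.encard_union_eq h4, Set.encard_union_eq h5,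
          Set.encard_singleton]
      _ ≤ D.secondOutDegree b := Set.encard_le_encard h2
  refine ⟨X.center, b, ?_, hx, hb'⟩
  rintro rfl
  exact h.irrefl _ (hBx _ hb)

end MissesDependentStars
end Digraph

/-! ### Contracting a module. -/

namespace Digraph

variable {V : Type*} {D : Digraph V}

/-- Let all vertices of `K` have the same neighbours outside `K`, and let all pairs not inside
`K` be adjacent. Then two vertices have the second neighbourhood property, unless the vertices of
`K` have at most as many out-neighbours as second out-neighbours outside `K`. -/
theorem encard_le_or_exists_hasSNP_of_module [Finite V] (hirr : ∀ v, ¬ D.Adj v v)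
    (hasymm : ∀ u v, D.Adj u v → ¬ D.Adj v u) (hsink : ∀ v, ∃ t, D.Adj v t) {K : Set V} (x : V)
    (hx : K.Nonempty → x ∈ K) (htot : ∀ u, ∀ w ∉ K, u ≠ w → D.Adj u w ∨ D.Adj w u)
    (hK : ∀ u ∈ K, ∀ w ∉ K, D.Adj u w ↔ D.Adj x w) :
    (x ∈ K ∧ {w | w ∉ K ∧ D.Adj x w}.encard ≤
      {w | w ∉ K ∧ ¬ D.Adj x w ∧ ∃ u, u ∉ K ∧ D.Adj x u ∧ D.Adj u w}.encard) ∨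
    ∃ u v : V, u ≠ v ∧ D.HasSNP u ∧ D.HasSNP v := by
  classical
  cases nonempty_fintype V
  have hK' : ∀ u ∈ K, ∀ w ∉ K, D.Adj w u ↔ D.Adj w x := by
    intro u hu w hw
    have hne : ∀ v ∈ K, v ≠ w := by
      rintro v hv rfl
      exact hw hv
    have hxK := hx ⟨u, hu⟩
    have h1 := hK u hu w hw
    constructor
    · intro h
      exact (htot x w hw (hne x hxK)).resolve_left fun h' => hasymm _ _ h (h1.2 h')
    · intro h
      exact (htot u w hw (hne u hu)).resolve_left fun h' => hasymm _ _ h (h1.1 h')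
  -- π contracts K to x, S is the set of its fixed points and ω the size of its fibres, so weights
  -- over S count vertices of D.
  let π : V → V := fun u => if u ∈ K then x else u
  have hπK : ∀ u ∈ K, π u = x := fun u hu => if_pos hu
  have hπ : ∀ u ∉ K, π u = u := fun u hu => if_neg hu
  let S : Finset V := Finset.univ.filter fun v => π v = v
  have hS : ∀ v, v ∈ S ↔ π v = v := fun v => by simp [S]
  have hSK : ∀ v ∈ S, v ∈ K → v = x := fun v hv hvK => ((hS v).1 hv).symm.trans (hπK v hvK)
  have hπS : ∀ u, π u ∈ S := by
    intro u
    rw [hS]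
    by_cases hu : u ∈ K
    · rw [hπK u hu, hπK x (hx ⟨u, hu⟩)]
    · rw [hπ u hu, hπ u hu]
  let ω : V → ℕ := fun v => (Finset.univ.filter fun u => π u = v).card
  have hsum : ∀ (p : V → Prop) [DecidablePred p],
      ∑ w ∈ S with p w, ω w = (Finset.univ.filter fun u => p (π u)).card := by
    intro p _
    rw [Finset.card_eq_sum_card_fiberwise (f := π) (t := S.filter p)]
    · refine Finset.sum_congr rfl fun w hw => ?_
      change Finset.card _ = _
      congr 1
      ext u
      simp only [Finset.mem_filter, Finset.mem_univ, true_and] at hw ⊢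
      constructor
      · rintro rfl
        exact ⟨hw.2, rfl⟩
      · exact fun h => h.2
    · intro u hu
      simpa [hπS u] using hu
  have henc : ∀ p : V → Prop, {w | p w}.encard = (Finset.univ.filter p).card := by
    intro p
    rw [← Set.encard_coe_eq_coe_finsetCard]
    congr 1
    ext
    simp
  have hstot : ∀ u ∈ S, ∀ v ∈ S, u ≠ v → D.Adj u v ∨ D.Adj v u := by
    intro u hu v hv huv
    by_cases hvK : v ∈ K
    · refine (htot v u (fun huK => huv ?_) huv.symm).symm
      rw [hSK u hu huK, hSK v hv hvK]
    · exact htot u v hvK huv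
  have hω : ∀ v ∈ S, 1 ≤ ω v := by
    intro v hv
    exact Finset.card_pos.2 ⟨v, by simpa using (hS v).1 hv⟩
  have hcenter : x ∈ K → D.HasWeightedSNP S ω x → {w | w ∉ K ∧ D.Adj x w}.encard ≤
      {w | w ∉ K ∧ ¬ D.Adj x w ∧ ∃ u, u ∉ K ∧ D.Adj x u ∧ D.Adj u w}.encard := by
    intro hxK h
    unfold HasWeightedSNP at h
    rw [hsum, hsum] at h
    rw [henc, henc, Nat.cast_le]
    refine le_trans (Finset.card_le_card ?_) (h.trans (Finset.card_le_card ?_))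
    · intro w
      simp only [Finset.mem_filter, Finset.mem_univ, true_and]
      rintro ⟨hw, h'⟩
      rwa [hπ w hw]
    · intro w
      simp only [Finset.mem_filter, Finset.mem_univ, true_and]
      rintro ⟨h1, h2, u, hu, h3, h4⟩
      have hw : w ∉ K := fun hw => h1 (hπK w hw)
      rw [hπ w hw] at h2 h4
      refine ⟨hw, h2, u, fun huK => ?_, h3, h4⟩
      rw [hSK u hu huK] at h3
      exact hirr _ h3
  -- Seen from f, the vertices of K are all or none out-neighbours, and a path of length two to x
  -- lifts to one to each vertex of K.
  have houter : ∀ f, f ∉ K → D.HasWeightedSNP S ω f → D.HasSNP f := by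
    intro f hf h
    unfold HasWeightedSNP at h
    rw [hsum, hsum] at h
    unfold HasSNP outDegree secondOutDegree outNbhd secondOutNbhd
    rw [henc, henc, Nat.cast_le]
    have hadj : ∀ u, D.Adj f (π u) ↔ D.Adj f u := by
      intro u
      by_cases hu : u ∈ K
      · rw [hπK u hu, hK' u hu f hf]
      · rw [hπ u hu]
    simp only [hadj] at h
    refine h.trans (Finset.card_le_card ?_)
    intro w
    simp only [Finset.mem_filter, Finset.mem_univ, true_and]
    rintro ⟨h1, h2, u, hu, h3, h4⟩
    by_cases hw : w ∈ K
    · refine ⟨?_, h2, u, h3, ?_⟩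
      · rintro rfl
        exact hf hw
      · rw [hπK w hw] at h4
        have huK : u ∉ K := by
          intro huK
          rw [hSK u hu huK] at h4
          exact hirr _ h4
        exact (hK' w hw u huK).2 h4
    · rw [hπ w hw] at h1 h4
      exact ⟨h1, h2, u, h3, h4⟩
  obtain ⟨f, hfS, hf⟩ := exists_hasWeightedSNP hirr hasymm hstot hω ⟨π x, hπS x⟩
  by_cases hfK : f ∈ K
  · obtain rfl := hSK f hfS hfK
    exact .inl ⟨hfK, hcenter hfK hf⟩
  -- A first vertex f outside K has a singleton fibre and an out-neighbour, as needed to find a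
  -- second one.
  · obtain ⟨t, ht⟩ := hsink f
    have hft : D.Adj f (π t) := by
      by_cases htK : t ∈ K
      · rwa [hπK t htK, ← hK' t htK f hfK]
      · rwa [hπ t htK]
    have hωf : ω f = 1 := by
      refine Finset.card_eq_one.2 ⟨f, ?_⟩
      ext u
      simp only [Finset.mem_filter, Finset.mem_univ, true_and, Finset.mem_singleton]
      constructor
      · intro h
        by_cases hu : u ∈ K
        · rw [hπK u hu] at h
          exact absurd (h ▸ hx ⟨u, hu⟩) hfK
        · rwa [hπ u hu] at h
      · rintro rfl
        exact hπ _ hfK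
    obtain ⟨g, hgS, hgf, hg⟩ := exists_ne_hasWeightedSNP hirr hasymm hstot hω hfS hωf (hπS t) hft
    by_cases hgK : g ∈ K
    · obtain rfl := hSK g hgS hgK
      exact .inl ⟨hgK, hcenter hgK hg⟩
    · exact .inr ⟨g, f, hgf, houter g hgK hg, houter f hfK hf⟩

theorem MissesDependentStars.exists_hasSNP [Finite V] {X Y Z : StarGraph V}
    (h : D.MissesDependentStars X Y Z) (hsink : ∀ v, ∃ t, D.Adj v t) :
    ∃ u v : V, u ≠ v ∧ D.HasSNP u ∧ D.HasSNP v := by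
  by_cases hne : X.leaves.Nonempty
  · have hneY := h.leaves_nonempty_of_leaves_nonempty hne
    have hneZ := h.rotate.leaves_nonempty_of_leaves_nonempty hneY
    set K : Set V := {v | v ∈ X.verts ∨ v ∈ Y.verts ∨ v ∈ Z.verts} with hK
    have hKc : ∀ w, w ∉ K → w ∉ X.verts ∧ w ∉ Y.verts ∧ w ∉ Z.verts := by
      intro w hw
      simpa [hK] using hw
    have hmod : ∀ u ∈ K, ∀ w ∉ K, D.Adj u w ↔ D.Adj X.center w := by
      intro u hu w hw
      obtain ⟨h1, h2, h3⟩ := hKc w hw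
      exact h.adj_iff_adj_X_center hne hu h1 h2 h3
    have hxK : X.center ∈ K := .inl (.inl rfl)
    rcases encard_le_or_exists_hasSNP_of_module h.irrefl h.asymm hsink X.center (fun _ => hxK)
      (fun u w hw huw => h.adj_or_of_notMem (hKc w hw).1 (hKc w hw).2.1 (hKc w hw).2.2 huw) hmod
      with ⟨-, hPQ⟩ | h'
    · have hP : ∀ u ∈ K, ∀ w ∉ K, D.Adj u w ↔ w ∈ {w | w ∉ K ∧ D.Adj X.center w} := by
        intro u hu w hw
        rw [hmod u hu w hw]
        exact ⟨fun h' => ⟨hw, h'⟩, fun h' => h'.2⟩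
      -- Three sizes cannot strictly decrease around a cycle, so some rotation of the stars meets
      -- the size condition.
      have key : Z.leaves.encard ≤ X.leaves.encard ∨ X.leaves.encard ≤ Y.leaves.encard ∨
          Y.leaves.encard ≤ Z.leaves.encard := by
        by_contra! hcon
        exact lt_irrefl _ (hcon.1.trans (hcon.2.2.trans hcon.2.1))
      have hQ : ∀ w ∈ {w | w ∉ K ∧ ¬ D.Adj X.center w ∧
          ∃ u, u ∉ K ∧ D.Adj X.center u ∧ D.Adj u w},
          ∃ u ∈ {w | w ∉ K ∧ D.Adj X.center w}, D.Adj u w := by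
        rintro w ⟨-, -, u, hu, h1, h2⟩
        exact ⟨u, ⟨hu, h1⟩, h2⟩
      rcases key with hle | hle | hle
      · exact h.exists_hasSNP_of_encard_le hneY hle (fun v => Iff.rfl) hP (fun w hw => hw.1)
          (fun w hw => hw.1) (fun w hw h' => hw.2.1 h'.2) hQ hPQ
      · exact h.rotate.exists_hasSNP_of_encard_le hneZ hle
          (fun v => ⟨fun h => (or_rotate.1 h), fun h => or_rotate.2 h⟩) hP (fun w hw => hw.1)
          (fun w hw => hw.1) (fun w hw h' => hw.2.1 h'.2) hQ hPQ
      · exact h.rotate.rotate.exists_hasSNP_of_encard_le hne hle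
          (fun v => ⟨fun h => or_rotate.1 (or_rotate.1 h), fun h => or_rotate.2 (or_rotate.2 h)⟩)
          hP (fun w hw => hw.1)
          (fun w hw => hw.1) (fun w hw h' => hw.2.1 h'.2) hQ hPQ
    · exact h'
  -- With no leaves anywhere D is a tournament. Taking K empty makes the alternative with x in K
  -- impossible.
  · have hY : ¬ Y.leaves.Nonempty := fun hY => hne
      (h.rotate.rotate.leaves_nonempty_of_leaves_nonempty
        (h.rotate.leaves_nonempty_of_leaves_nonempty hY))
    have hZ : ¬ Z.leaves.Nonempty := fun hZ => hne
      (h.rotate.rotate.leaves_nonempty_of_leaves_nonempty hZ)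
    rw [Set.not_nonempty_iff_eq_empty] at hne hY hZ
    rcases encard_le_or_exists_hasSNP_of_module h.irrefl h.asymm hsink (K := ∅) X.center
      (fun h' => absurd h' Set.not_nonempty_empty)
      (fun u w _ huw => h.adj_or u w huw (by simp [StarGraph.edges, hne])
        (by simp [StarGraph.edges, hY]) (by simp [StarGraph.edges, hZ]))
      (fun u hu => absurd hu (Set.notMem_empty u)) with ⟨h', -⟩ | h'
    · exact absurd h' (Set.notMem_empty _)
    · exact h'

end Digraph

/-! ### The theorem for deleted stars. -/

theorem theorem9 {V : Type*} [Finite V] (T D : Digraph V) (hT : T.IsTournament)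
    (Sx Sy Sz : StarGraph V)
    (hxy : Disjoint Sx.verts Sy.verts) (hyz : Disjoint Sy.verts Sz.verts)
    (hzx : Disjoint Sz.verts Sx.verts)
    (hD : D = T.deleteEdges (Sx.edges ∪ Sy.edges ∪ Sz.edges))
    (htriangle : D.Adj Sx.center Sy.center ∧ D.Adj Sy.center Sz.center ∧
      D.Adj Sz.center Sx.center)
    (hout : 0 < D.dependencyDigraph.minOutDegree)
    (hin : 0 < D.dependencyDigraph.minInDegree)
    (hsink : ∀ v, ¬ D.IsSink v) :
    ∃ u v : V, u ≠ v ∧ D.HasSNP u ∧ D.HasSNP v := by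
  have hne : ∀ (S : StarGraph V), ∀ a ∈ S.leaves, S.center ≠ a := by
    rintro S a ha rfl
    exact S.center_notMem ha
  have hadj : ∀ u v, D.Adj u v ↔ T.Adj u v ∧ ¬ (s(u, v) ∈ Sx.edges ∨ s(u, v) ∈ Sy.edges ∨
      s(u, v) ∈ Sz.edges) := by
    intro u v
    rw [hD, ← or_assoc]
    rfl
  -- The vertices of Δ are exactly the star edges, so the degree conditions speak of them alone.
  have hmiss : ∀ e, (e ∈ Sx.edges ∨ e ∈ Sy.edges ∨ e ∈ Sz.edges) ↔
      e ∈ D.missingGraph.edgeSet := by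
    intro e
    induction e using Sym2.ind with
    | _ u v =>
    rw [SimpleGraph.mem_edgeSet]
    constructor
    · intro h
      refine ⟨?_, fun h' => ((hadj u v).1 h').2 h, fun h' => ((hadj v u).1 h').2 ?_⟩
      · rintro rfl
        simp only [StarGraph.mk_mem_edges] at h
        rcases h with (⟨h, h'⟩ | ⟨h, h'⟩) | (⟨h, h'⟩ | ⟨h, h'⟩) | (⟨h, h'⟩ | ⟨h, h'⟩) <;>
          exact hne _ _ h' h.symm
      · rwa [Sym2.eq_swap]
    · rintro ⟨h1, h2, h3⟩
      by_contra hcon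
      rcases hT.connected u v h1 with h | h
      · exact h2 ((hadj u v).2 ⟨h, hcon⟩)
      · exact h3 ((hadj v u).2 ⟨h, by rwa [Sym2.eq_swap]⟩)
  have hnadj : ∀ S : StarGraph V, (∀ e ∈ S.edges, e ∈ D.missingGraph.edgeSet) →
      ∀ a ∈ S.leaves, ¬ D.Adj S.center a ∧ ¬ D.Adj a S.center := by
    intro S hS a ha
    exact ((D.missingGraph.mem_edgeSet).1 (hS s(S.center, a) ⟨a, ha, rfl⟩)).2
  have h : D.MissesDependentStars Sx Sy Sz :=
    { irrefl := fun v hv => hT.loopless v ((hadj v v).1 hv).1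
      asymm := fun u v hu hv => hT.no_digon u v ((hadj u v).1 hu).1 ((hadj v u).1 hv).1
      disjoint_XY := fun _ h1 h2 => Set.disjoint_left.1 hxy h1 h2
      disjoint_YZ := fun _ h1 h2 => Set.disjoint_left.1 hyz h1 h2
      disjoint_ZX := fun _ h1 h2 => Set.disjoint_left.1 hzx h1 h2
      adj_or := by
        intro u v huv h1 h2 h3
        by_contra! hcon
        have := (hmiss s(u, v)).2 ((D.missingGraph.mem_edgeSet).2 ⟨huv, hcon.1, hcon.2⟩)
        tauto
      not_adj_X := hnadj Sx fun e he => (hmiss e).1 (.inl he)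
      not_adj_Y := hnadj Sy fun e he => (hmiss e).1 (.inr (.inl he))
      not_adj_Z := hnadj Sz fun e he => (hmiss e).1 (.inr (.inr he))
      adj_XY := htriangle.1
      adj_YZ := htriangle.2.1
      adj_ZX := htriangle.2.2
      exists_losesTo := by
        intro e he
        have h0 := hout.trans_le (iInf_le _ ⟨e, (hmiss e).1 he⟩)
        obtain ⟨f, hf⟩ := Set.encard_pos.1 h0
        exact ⟨f, (hmiss f).2 f.2, hf⟩
      exists_losesTo_left := by
        intro e he
        have h0 := hin.trans_le (iInf_le _ ⟨e, (hmiss e).1 he⟩)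
        obtain ⟨f, hf⟩ := Set.encard_pos.1 h0
        exact ⟨f, (hmiss f).2 f.2, hf⟩ }
  refine h.exists_hasSNP fun v => ?_
  obtain ⟨t, ht⟩ := Set.encard_ne_zero.1 (hsink v)
  exact ⟨t, ht⟩
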